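/- **Setting.** All quantities below may depend on an index $n$, and limits are taken as $|\Psi_1|\to\infty$. Let $A^{(1)},\dots,A^{(T)}\in\{0,1\}^{N\times N}$ ($T\ge 1$) be symmetric adjacency matrices with zero diagonal whose entries $A^{(t)}_{ij}$, $i<j$, are independent with $A^{(t)}_{ij}\sim\mathrm{Bernoulli}(P^{(t)}_{ij})$ and $\operatorname{logit}(P^{(t)}_{ij})=\alpha_i+\alpha_j+z_i^{(t)\top}z_j^{(t)}$. Here $\alpha\in\mathbb R^N$ and $Z^{(t)}=(z^{(t)}_1,\dots,z^{(t)}_N)^\top\in\mathbb R^{N\times d_t}$ are non-random, and $Z^{(t)}$ is centred: $JZ^{(t)}=Z^{(t)}$ with $J=I_N-1_N1_N^\top/N$. Put $P^{(t)}=P^{(t)\top}=E A^{(t)}$, so $P^{(t)}_{ii}=0$. The set $\Psi=\{1,\dots,N\}^2$ is divided into non-random symmetric parts $\Psi_1,\Psi_2$, and $\Psi_1$ is divided into $K\ge 2$ folds $G_1,\dots,G_K$ (evenly in practice; equal sizes are not needed). Write $A^{(t)}(S)$ for $A^{(t)}$ with the entries outside $S\subseteq\Psi$ replaced by $0$. The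 $m$-th of the $M$ candidate models ($m=1,\dots,M$) has latent dimension $m$ in every layer. It is fitted to matrices $B^{(t)}$, $t\le T$, by projected gradient descent: from initial values $\alpha_0\in\mathbb R^N$, $Z^{(t)}_0\in\mathbb R^{N\times m}$, the algorithm performs $U$ iterations $$\Theta^{(t)}_u=\alpha_u1_N^\top+1_N\alpha_u^\top+Z_u^{(t)}Z_u^{(t)\top},$$ $$Z^{(t)}_{u+1}=J\bigl[Z^{(t)}_u+2\eta_Z\{B^{(t)}-\sigma(\Theta^{(t)}_u)\}Z^{(t)}_u\bigr],$$ $$\alpha_{u+1}=\alpha_u+2\eta_\alpha\sum_{t=1}^T\{B^{(t)}-\sigma(\Theta_u^{(t)})\}1_N,$$ where $\sigma(x)=1/(1+e^{-x})$ is applied entrywise. The initial values, step sizes and $U$ may be arbitrary functions of the matrices fitted, and may differ between runs. If $\widehat\Theta^{(t)}_{(m)}$ is the value of $\alpha 1_N^\top+1_N\alpha^\top+Z^{(t)}Z^{(t)\top}$ at the output of the run on $A^{(t)}(\Psi_1)$, and $\widetilde\Theta^{(t)[-k]}_{(m)}$ its value for the run on $A^{(t)}(\Psi_1\setminus G_k)$,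 put $$\widehat P^{(t)}_{(m),ij}=\frac{|\Psi|}{|\Psi_1|}\,\sigma\bigl(\widehat\Theta^{(t)}_{(m),ij}\bigr),\qquad \widetilde P^{(t)}_{(m),ij}=\frac{K}{K-1}\,\sigma\bigl(\widetilde\Theta^{(t)[-k]}_{(m),ij}\bigr)\quad\text{for }(i,j)\in G_k .$$ Let $\mathcal W=\{w\in[0,1]^M:\sum_m w_m=1\}$ and let $\widehat w_\dagger$ be any minimiser over $\mathcal W$ of the $K$-fold edge cross-validation criterion $$CV_\dagger(w)=\frac1{T|\Psi_1|}\sum_{t=1}^T\sum_{(i,j)\in\Psi_1}\Bigl(A^{(t)}_{ij}-\sum_{m=1}^M w_m\widetilde P^{(t)}_{(m),ij}\Bigr)^2 .$$ Let $\mathcal T_\dagger=\{m\le M: m\ge d_t\text{ for all }t\}$ be the set of correct models, let $\mathcal W^s=\{w\in\mathcal W:\sum_{m\notin\mathcal T_\dagger}w_m=1\}$, and let $D_\dagger$ be such that $\max_{t,i,j}P^{(t)}_{ij}\le D_\dagger/N$. **Theorem 5.** Suppose that the following hold. 1. (Assumption 8) $M\le N$, and there are non-random limiting values $P^{(t)*}_{(m),ij}$,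 $(i,j)\in\Psi_1$, such that $$\max_{m\le M}\sum_{t=1}^T\sum_{(i,j)\in\Psi_1}\bigl(\widehat P^{(t)}_{(m),ij}-P^{(t)*}_{(m),ij}\bigr)^2=O_p(NMT),\qquad \max_{m\le M}\sum_{t=1}^T\sum_{(i,j)\in\Psi_1}\bigl(\widetilde P^{(t)}_{(m),ij}-P^{(t)*}_{(m),ij}\bigr)^2=O_p(NMT).$$ For correct models these values are the true ones: $P^{(t)*}_{(m),ij}=P^{(t)}_{ij}$ for $m\in\mathcal T_\dagger$ and $(i,j)\in\Psi_1$ with $i\ne j$. 2. (Assumption 9) $TN^{-C_0}=o(1)$ for some constant $C_0>0$. 3. (Assumption 11) With $L^*_\dagger(w)=\sum_{t=1}^T\sum_{(i,j)\in\Psi_1}\bigl(\sum_m w_mP^{(t)*}_{(m),ij}-P^{(t)}_{ij}\bigr)^2$, $$NMT\Bigl\{\inf_{w\in\mathcal W^s}L^*_\dagger(w)\Bigr\}^{-1}=o(1),\qquad NT\max\{D_\dagger,\log N\}\Bigl\{\inf_{w\in\mathcal W^s}L^*_\dagger(w)\Bigr\}^{-1}=O(1)$$ (the infimum over the empty set being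 $\infty$). If $\mathcal T_\dagger\neq\emptyset$, then $\widehat\zeta_\dagger=\sum_{m\in\mathcal T_\dagger}\widehat w_{\dagger,m}\to1$ in probability. -/

import Mathlib

open MeasureTheory ProbabilityTheory Filter Topology

namespace NetMA

noncomputable section

/-- Logistic function `σ(x) = 1 / (1 + exp (-x))`, the inverse of `logit`. -/
def sigma (x : ℝ) : ℝ := 1 / (1 + Real.exp (-x))

/-- `Θ = α 1ᵀ + 1 αᵀ + Z Zᵀ`. -/
def theta {N d : ℕ} (α : Fin N → ℝ) (Z : Matrix (Fin N) (Fin d) ℝ) : Matrix (Fin N) (Fin N) ℝ :=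
  Matrix.of fun i j => α i + α j + (Z * Z.transpose) i j

/-- The centring matrix `J = I - 1 1ᵀ / N`. -/
def centering (N : ℕ) : Matrix (Fin N) (Fin N) ℝ :=
  1 - (1 / (N : ℝ)) • Matrix.of fun _ _ => (1 : ℝ)

/-! ### Data-generating model -/

/-- Fixed-effect parameters of a multi-layer inner-product latent space model with `N` nodes and
`T` layers: shared `α`, and in layer `t` centred latent positions of true dimension `d t`. -/
structure Model (N T : ℕ) where
  alpha : Fin N → ℝ
  d : Fin T → ℕ
  Z : (t : Fin T) → Matrix (Fin N) (Fin (d t)) ℝ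
  centered : ∀ t, centering N * Z t = Z t

/-- `P⁽ᵗ⁾ = E A⁽ᵗ⁾`: `logit P_ij = Θ_ij` off the diagonal, and `P_ii = 0` as there are no loops. -/
def Model.prob {N T : ℕ} (θ : Model N T) (t : Fin T) : Matrix (Fin N) (Fin N) ℝ :=
  Matrix.of fun i j => if i = j then 0 else sigma (theta θ.alpha (θ.Z t) i j)

/-- `A` is a multi-layer random network from the model: symmetric loop-free 0-1 adjacency matrices
whose entries above the diagonal are independent Bernoulli variables with success probabilities
`P⁽ᵗ⁾_ij`. -/
structure IsNetwork {N T : ℕ} {Ω : Type*} [MeasurableSpace Ω] (θ : Model N T) (μ : Measure Ω)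
    (A : Ω → Fin T → Matrix (Fin N) (Fin N) ℝ) : Prop where
  measurable : ∀ t i j, Measurable fun ω => A ω t i j
  binary : ∀ ω t i j, A ω t i j = 0 ∨ A ω t i j = 1
  symm : ∀ ω t i j, A ω t i j = A ω t j i
  diag : ∀ ω t i, A ω t i i = 0
  bernoulli : ∀ t i j, i < j → μ {ω | A ω t i j = 1} = ENNReal.ofReal (θ.prob t i j)
  indep : iIndepFun
    (fun (e : {e : Fin T × Fin N × Fin N // e.2.1 < e.2.2}) (ω : Ω) =>
      A ω e.1.1 e.1.2.1 e.1.2.2) μ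

/-! ### Projected gradient descent -/

/-- Inputs of the algorithm besides the adjacency matrices: initial values, step sizes and number
of iterations, for latent dimension `m`. -/
structure PGDInput (N T m : ℕ) where
  alpha0 : Fin N → ℝ
  Z0 : Fin T → Matrix (Fin N) (Fin m) ℝ
  etaAlpha : ℝ
  etaZ : ℝ
  iters : ℕ

/-- A rule that computes these inputs from the adjacency matrices handed to the algorithm. -/
abbrev PGDRule (N T m : ℕ) := (Fin T → Matrix (Fin N) (Fin N) ℝ) → PGDInput N T m

/-- The residual `A⁽ᵗ⁾ - σ(Θ⁽ᵗ⁾)` at a current iterate. -/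
def residual {N T m : ℕ} (A : Fin T → Matrix (Fin N) (Fin N) ℝ)
    (x : (Fin N → ℝ) × (Fin T → Matrix (Fin N) (Fin m) ℝ)) (t : Fin T) :
    Matrix (Fin N) (Fin N) ℝ :=
  A t - (theta x.1 (x.2 t)).map sigma

/-- One iteration: all `Z⁽ᵗ⁾` take a gradient step and are centred, then `α` takes a gradient step
(both at the current `Θ`). -/
def pgdStep {N T m : ℕ} (A : Fin T → Matrix (Fin N) (Fin N) ℝ) (etaAlpha etaZ : ℝ)
    (x : (Fin N → ℝ) × (Fin T → Matrix (Fin N) (Fin m) ℝ)) :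
    (Fin N → ℝ) × (Fin T → Matrix (Fin N) (Fin m) ℝ) :=
  (x.1 + (2 * etaAlpha) • (∑ t, residual A x t).mulVec (fun _ => 1),
    fun t => centering N * (x.2 t + (2 * etaZ) • (residual A x t * x.2 t)))

/-- Output `(α̂, (Ẑ⁽ᵗ⁾)ₜ)` of the algorithm. -/
def pgd {N T m : ℕ} (rule : PGDRule N T m) (A : Fin T → Matrix (Fin N) (Fin N) ℝ) :
    (Fin N → ℝ) × (Fin T → Matrix (Fin N) (Fin m) ℝ) :=
  (pgdStep A (rule A).etaAlpha (rule A).etaZ)^[(rule A).iters] ((rule A).alpha0, (rule A).Z0)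

/-- `A(S)`: the entries with indices outside `S` are set to zero. -/
def restrict {N T : ℕ} (S : Finset (Fin N × Fin N)) (A : Fin T → Matrix (Fin N) (Fin N) ℝ) :
    Fin T → Matrix (Fin N) (Fin N) ℝ :=
  fun t => Matrix.of fun i j => if (i, j) ∈ S then A t i j else 0

/-! ### The whole setting for one network -/

/-- A network model together with the averaging procedure: `M` candidate models, the symmetric set
`Ψ₁` of observed nodal pairs, its division into `K` folds, and the algorithm inputs used in each
run. The candidate with index `m : Fin M` has latent dimension `m + 1`. -/
structure Setting where
  N : ℕ
  T : ℕ
  M : ℕ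
  K : ℕ
  T_pos : 1 ≤ T
  two_le_K : 2 ≤ K
  model : Model N T
  Psi1 : Finset (Fin N × Fin N)
  Psi1_symm : ∀ i j, (i, j) ∈ Psi1 → (j, i) ∈ Psi1
  fold : Fin N × Fin N → Fin K
  rule : (m : Fin M) → PGDRule N T (m + 1)
  foldRule : (m : Fin M) → Fin K → PGDRule N T (m + 1)

namespace Setting

variable (S : Setting)

/-- Adjacency matrices of all the layers. -/
abbrev Adj : Type := Fin S.T → Matrix (Fin S.N) (Fin S.N) ℝ

/-- `G_k`, the nodal pairs of `Ψ₁` in the fold `k`. -/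
def G (k : Fin S.K) : Finset (Fin S.N × Fin S.N) := S.Psi1.filter fun e => S.fold e = k

/-- `f₁(x) = K / {(1 + exp (-x)) (K - 1)}`. -/
def f1 (x : ℝ) : ℝ := S.K / ((1 + Real.exp (-x)) * ((S.K : ℝ) - 1))

/-- `f₂(x) = |Ψ| / {(1 + exp (-x)) |Ψ₁|}`, where `Ψ` is the set of all nodal pairs. -/
def f2 (x : ℝ) : ℝ :=
  ((Finset.univ : Finset (Fin S.N × Fin S.N)).card : ℝ) / ((1 + Real.exp (-x)) * S.Psi1.card)

/-- `P̂⁽ᵗ⁾₍ₘ₎`, from the fit of the candidate `m` to `A(Ψ₁)`. -/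
def Phat (A : S.Adj) (m : Fin S.M) (t : Fin S.T) : Matrix (Fin S.N) (Fin S.N) ℝ :=
  (theta (pgd (S.rule m) (restrict S.Psi1 A)).1
    ((pgd (S.rule m) (restrict S.Psi1 A)).2 t)).map S.f2

/-- `P̃⁽ᵗ⁾[k]₍ₘ₎`, the prediction on the fold `k` from the fit of the candidate `m` to the remaining
pairs of `Ψ₁`; it is zero outside of the fold. -/
def Ptilde (A : S.Adj) (m : Fin S.M) (k : Fin S.K) (t : Fin S.T) :
    Matrix (Fin S.N) (Fin S.N) ℝ :=
  Matrix.of fun i j => if (i, j) ∈ S.G k then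
    S.f1 (theta (pgd (S.foldRule m k) (restrict (S.Psi1 \ S.G k) A)).1
      ((pgd (S.foldRule m k) (restrict (S.Psi1 \ S.G k) A)).2 t) i j) else 0

/-- The `K`-fold edge cross-validation criterion
`CV(w) = (T |Ψ₁|)⁻¹ ∑ₜ ∑ₖ ‖A⁽ᵗ⁾[k] - ∑ₘ wₘ P̃⁽ᵗ⁾[k]₍ₘ₎‖_F²`. -/
def CV (A : S.Adj) (w : Fin S.M → ℝ) : ℝ :=
  1 / ((S.T : ℝ) * S.Psi1.card) * ∑ t, ∑ k, ∑ i, ∑ j,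
    (restrict (S.G k) A t i j - ∑ m, w m * S.Ptilde A m k t i j) ^ 2

/-- `𝒯`: the candidates whose dimension is at least the true one in every layer. -/
def correct : Finset (Fin S.M) := Finset.univ.filter fun m => ∀ t, S.model.d t ≤ (m : ℕ) + 1

/-- `𝒲`: the weight vectors. -/
def weights : Set (Fin S.M → ℝ) := stdSimplex ℝ (Fin S.M)

/-- `𝒲ˢ`: the weight vectors with all weight on misspecified candidates. -/
def misspecifiedWeights : Set (Fin S.M → ℝ) :=
  {w ∈ S.weights | ∑ m ∈ S.correctᶜ, w m = 1}

/-- `ŵ` is a minimiser of the cross-validation criterion over `𝒲`. -/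
def IsCVWeight (A : S.Adj) (w : Fin S.M → ℝ) : Prop :=
  w ∈ S.weights ∧ ∀ v ∈ S.weights, S.CV A w ≤ S.CV A v

/-- Arrays of limiting values `P*⁽ᵗ⁾₍ₘ₎`. -/
abbrev Limits : Type := Fin S.M → Fin S.T → Matrix (Fin S.N) (Fin S.N) ℝ

/-- `∑ₜ ∑_{(i,j) ∈ Ψ₁} (P̂⁽ᵗ⁾₍ₘ₎,ᵢⱼ - P*⁽ᵗ⁾₍ₘ₎,ᵢⱼ)²`. -/
def fitError (A : S.Adj) (Pstar : S.Limits) (m : Fin S.M) : ℝ :=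
  ∑ t, ∑ e ∈ S.Psi1, (S.Phat A m t e.1 e.2 - Pstar m t e.1 e.2) ^ 2

/-- The same for the cross-validation predictions `P̃⁽ᵗ⁾₍ₘ₎ = ∑ₖ P̃⁽ᵗ⁾[k]₍ₘ₎`. -/
def foldError (A : S.Adj) (Pstar : S.Limits) (m : Fin S.M) : ℝ :=
  ∑ t, ∑ e ∈ S.Psi1, (∑ k, S.Ptilde A m k t e.1 e.2 - Pstar m t e.1 e.2) ^ 2

/-- `L*(w) = ∑ₜ ∑_{(i,j) ∈ Ψ₁} (∑ₘ wₘ P*⁽ᵗ⁾₍ₘ₎,ᵢⱼ - P⁽ᵗ⁾ᵢⱼ)²`. -/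
def lossStar (Pstar : S.Limits) (w : Fin S.M → ℝ) : ℝ :=
  ∑ t, ∑ e ∈ S.Psi1, (∑ m, w m * Pstar m t e.1 e.2 - S.model.prob t e.1 e.2) ^ 2

/-- `inf_{w ∈ 𝒲ˢ} L*(w)` in `[0, ∞]`; it is `∞` if no candidate is misspecified. -/
def infLossStar (Pstar : S.Limits) : ENNReal :=
  ⨅ w ∈ S.misspecifiedWeights, ENNReal.ofReal (S.lossStar Pstar w)

end Setting

/-! ### Asymptotics along a sequence of settings -/

/-- `X n m = O_p(r n)` uniformly in `m`, i.e. `maxₘ |X n m| = O_p(r n)`. -/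
def UniformBigOp {Ω : ℕ → Type*} [∀ n, MeasurableSpace (Ω n)] (μ : ∀ n, Measure (Ω n))
    {ι : ℕ → Type*} (X : (n : ℕ) → ι n → Ω n → ℝ) (r : ℕ → ℝ) : Prop :=
  ∀ ε : ℝ, 0 < ε → ∃ C : ℝ, ∀ᶠ n in atTop,
    μ n {ω | ∃ m, C * r n < |X n m ω|} ≤ ENNReal.ofReal ε

/-- `X n → c` in probability, where `X n` may live on a probability space depending on `n`. -/
def TendstoInProb {Ω : ℕ → Type*} [∀ n, MeasurableSpace (Ω n)] (μ : ∀ n, Measure (Ω n))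
    (X : (n : ℕ) → Ω n → ℝ) (c : ℝ) : Prop :=
  ∀ ε : ℝ, 0 < ε → Tendsto (fun n => μ n {ω | ε ≤ |X n ω - c|}) atTop (𝓝 0)

/-- `M ≤ N`, and uniformly in the candidates the estimators `P̂₍ₘ₎` and the cross-validation
predictions `P̃₍ₘ₎` have the limiting values `P*₍ₘ₎`, with squared error `O_p(NMT)` over `Ψ₁`. -/
structure HaveLimits (S : ℕ → Setting) {Ω : ℕ → Type*} [∀ n, MeasurableSpace (Ω n)]
    (μ : ∀ n, Measure (Ω n)) (A : (n : ℕ) → Ω n → (S n).Adj)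
    (Pstar : (n : ℕ) → (S n).Limits) : Prop where
  M_le_N : ∀ n, (S n).M ≤ (S n).N
  fit : UniformBigOp μ (fun n m ω => (S n).fitError (A n ω) (Pstar n) m)
    (fun n => (S n).N * (S n).M * (S n).T)
  fold : UniformBigOp μ (fun n m ω => (S n).foldError (A n ω) (Pstar n) m)
    (fun n => (S n).N * (S n).M * (S n).T)

/-- `N M T {inf_{𝒲ˢ} L*}⁻¹ = o(1)` and `N T max{D, log N} {inf_{𝒲ˢ} L*}⁻¹ = O(1)`, computed
in `[0, ∞]` with `0⁻¹ = ∞` and `∞⁻¹ = 0`. -/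
structure MisspecifiedLossGrows (S : ℕ → Setting) (Pstar : (n : ℕ) → (S n).Limits)
    (D : ℕ → ℝ) : Prop where
  little : Tendsto (fun n => ENNReal.ofReal ((S n).N * (S n).M * (S n).T) *
    ((S n).infLossStar (Pstar n))⁻¹) atTop (𝓝 0)
  big : ∃ C : ℝ, ∀ᶠ n in atTop,
    ENNReal.ofReal ((S n).N * (S n).T * max (D n) (Real.log (S n).N)) *
      ((S n).infLossStar (Pstar n))⁻¹ ≤ ENNReal.ofReal C

end

end NetMA

/-! ### Least-squares averaging for a fixed data set -/

namespace NetMA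

/-! The cross-validation criterion is a least-squares objective over the observed entries, and its
minimiser does at least as well as the vertex of the simplex at a correct candidate `m₀`. Expanding
the squares around the truth `P` bounds the squared error of the averaged prediction by that of `m₀`
plus a noise term, linear in `A - P`.

Replace predictions by their limits. Off the diagonal correct candidates have no bias, so the bias
of the average comes from the misspecified weight `s = 1 - ζ̂` alone. After renormalising that
weight to `v ∈ 𝒲ˢ`, its squared norm is `s² L*(v)`, whence `s² L*(v) ≤ 4R + 16NT + 8√(VR) + 4G`
(`sum_sq_bias_le`, `Setting.exists_misspecified_loss_le`). Here `R` bounds the fold errors, `V`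
bounds `‖A - P‖²`, and `G` bounds the noise against each non-random direction `P*₍ₘ₎ - P`.

Put `a = NMT` and `B = NT max{D, log N}`. With high probability `R = O(a)` by assumption, `V = O(B)`
by Markov, and `G = O(√(aB))` by Chebyshev and a union bound over the candidates. The loss
assumptions give `a = o(L*)` and `B = O(L*)`, so also `√(aB) = o(L*)`. The right-hand side is thus
`o(L*(v))`, which forces `s → 0` (`Setting.measure_le_abs_weight_sub_one_le`). -/

theorem sq_sum_mul_le {κ : Type*} (c : Finset κ) (w r : κ → ℝ) (hw : ∀ m ∈ c, 0 ≤ w m)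
    (hw1 : ∑ m ∈ c, w m ≤ 1) : (∑ m ∈ c, w m * r m) ^ 2 ≤ ∑ m ∈ c, w m * r m ^ 2 := by
  -- Cauchy–Schwarz: `(∑ w r)² ≤ (∑ w)(∑ w r²)`. Total weight below one is allowed, so that the
  -- bound also covers the misspecified candidates alone.
  have h := Finset.sum_sq_le_sum_mul_sum_of_sq_le_mul c (r := fun m => w m * r m)
    (f := w) (g := fun m => w m * r m ^ 2) hw
    (fun m hm => mul_nonneg (hw m hm) (sq_nonneg _)) (fun m _ => by ring_nf; rfl)
  refine h.trans (mul_le_of_le_one_left ?_ hw1)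
  exact Finset.sum_nonneg fun m hm => mul_nonneg (hw m hm) (sq_nonneg _)

theorem abs_sum_mul_le {κ : Type*} (c : Finset κ) (w f : κ → ℝ) (hw : ∀ m ∈ c, 0 ≤ w m)
    (hw1 : ∑ m ∈ c, w m ≤ 1) {b : ℝ} (hb : 0 ≤ b) (hf : ∀ m ∈ c, |f m| ≤ b) :
    |∑ m ∈ c, w m * f m| ≤ b := by
  calc |∑ m ∈ c, w m * f m| ≤ ∑ m ∈ c, |w m * f m| := Finset.abs_sum_le_sum_abs _ _
    _ ≤ ∑ m ∈ c, w m * b := Finset.sum_le_sum fun m hm => by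
        rw [abs_mul, abs_of_nonneg (hw m hm)]
        exact mul_le_mul_of_nonneg_left (hf m hm) (hw m hm)
    _ = (∑ m ∈ c, w m) * b := by rw [Finset.sum_mul]
    _ ≤ b := mul_le_of_le_one_left hb hw1

/-- Oracle inequality for least-squares averaging: if `w` beats the correct candidate `m₀`, then
the part of the averaged bias that comes from the other candidates is small. The correct candidates
have no bias outside of `diag`, where data and target vanish. -/
theorem sum_sq_bias_le {ι κ : Type*} [Fintype κ] [DecidableEq κ] (I : Finset ι)
    (a p : ι → ℝ) (x q : κ → ι → ℝ) (c : Finset κ) (w : κ → ℝ) (hw0 : ∀ m, 0 ≤ w m)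
    (hw1 : ∑ m, w m = 1) {m₀ : κ} (hm₀ : m₀ ∈ c) (diag : ι → Prop) [DecidablePred diag]
    (hq : ∀ m ∈ c, ∀ i ∈ I, ¬ diag i → q m i = p i) (hp : ∀ i, diag i → p i = 0)
    (ha : ∀ i, diag i → a i = 0) (hx : ∀ m i, |x m i| ≤ 2)
    (hopt : ∑ i ∈ I, (a i - ∑ m, w m * x m i) ^ 2 ≤ ∑ i ∈ I, (a i - x m₀ i) ^ 2)
    {R H G Q : ℝ} (hR : ∀ m, ∑ i ∈ I, (x m i - q m i) ^ 2 ≤ R)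
    (hH : ∀ m, |∑ i ∈ I, (a i - p i) * (x m i - q m i)| ≤ H)
    (hG : ∀ m, |∑ i ∈ I, (a i - p i) * (q m i - p i)| ≤ G)
    (hQ : ((I.filter diag).card : ℝ) ≤ Q) :
    ∑ i ∈ I, (∑ m ∈ cᶜ, w m * (q m i - p i)) ^ 2 ≤ 4 * R + 16 * Q + 8 * H + 4 * G := by
  have hdiag : ∑ i ∈ I, (if diag i then (1 : ℝ) else 0) ≤ Q := by
    rw [Finset.sum_boole]; exact hQ
  have hc1 : ∑ m ∈ cᶜ, w m ≤ 1 := by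
    rw [← hw1]
    exact Finset.sum_le_sum_of_subset_of_nonneg (Finset.subset_univ _) fun m _ _ => hw0 m
  have hH0 : 0 ≤ H := (abs_nonneg _).trans (hH m₀)
  have hG0 : 0 ≤ G := (abs_nonneg _).trans (hG m₀)
  have hsplit : ∀ i, ∑ m, w m * (x m i - p i) = ∑ m, w m * x m i - p i := fun i => by
    simp_rw [mul_sub, Finset.sum_sub_distrib, ← Finset.sum_mul, hw1, one_mul]
  -- pointwise bound of the bias
  have hpt : ∀ i ∈ I, (∑ m ∈ cᶜ, w m * (q m i - p i)) ^ 2 ≤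
      2 * (∑ m, w m * x m i - p i) ^ 2 + 2 * ∑ m, w m * (x m i - q m i) ^ 2 +
        8 * (if diag i then (1 : ℝ) else 0) := by
    intro i hi
    -- Diagonal predictions need not vanish, and diagonal limits of correct candidates are
    -- unconstrained. There only `|x| ≤ 2` helps, at the price `8 = 2 · 2²` per entry.
    by_cases hd : diag i
    · have h1 : ∑ m ∈ cᶜ, w m * (q m i - p i) =
          ∑ m ∈ cᶜ, w m * x m i - ∑ m ∈ cᶜ, w m * (x m i - q m i) := by
        rw [← Finset.sum_sub_distrib]
        refine Finset.sum_congr rfl fun m _ => ?_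
        rw [hp i hd]; ring
      have h2 := abs_le.1 (abs_sum_mul_le cᶜ w (fun m => x m i) (fun m _ => hw0 m) hc1
        zero_le_two fun m _ => hx m i)
      have h3 := sq_sum_mul_le cᶜ w (fun m => x m i - q m i) (fun m _ => hw0 m) hc1
      have h4 : ∑ m ∈ cᶜ, w m * (x m i - q m i) ^ 2 ≤ ∑ m, w m * (x m i - q m i) ^ 2 :=
        Finset.sum_le_sum_of_subset_of_nonneg (Finset.subset_univ _)
          fun m _ _ => mul_nonneg (hw0 m) (sq_nonneg _)
      rw [h1, if_pos hd]
      nlinarith [sq_nonneg (∑ m ∈ cᶜ, w m * x m i + ∑ m ∈ cᶜ, w m * (x m i - q m i)),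
        sq_nonneg (∑ m, w m * x m i - p i)]
    · have h1 : ∑ m ∈ cᶜ, w m * (q m i - p i) = ∑ m, w m * (q m i - p i) := by
        refine Finset.sum_subset (Finset.subset_univ _) fun m _ hm => ?_
        rw [hq m (by simpa using hm) i hi hd]; simp
      have h2 : ∑ m, w m * (q m i - p i) =
          (∑ m, w m * x m i - p i) - ∑ m, w m * (x m i - q m i) := by
        rw [← hsplit, ← Finset.sum_sub_distrib]
        exact Finset.sum_congr rfl fun m _ => by ring
      have h3 := sq_sum_mul_le Finset.univ w (fun m => x m i - q m i) (fun m _ => hw0 m) hw1.le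
      rw [h1, h2, if_neg hd]
      nlinarith [sq_nonneg ((∑ m, w m * x m i - p i) + ∑ m, w m * (x m i - q m i))]
  have hR' : ∑ i ∈ I, ∑ m, w m * (x m i - q m i) ^ 2 ≤ R := by
    rw [Finset.sum_comm]
    simp_rw [← Finset.mul_sum]
    calc ∑ m, w m * ∑ i ∈ I, (x m i - q m i) ^ 2 ≤ ∑ m, w m * R :=
          Finset.sum_le_sum fun m _ => mul_le_mul_of_nonneg_left (hR m) (hw0 m)
      _ = R := by rw [← Finset.sum_mul, hw1, one_mul]
  have hsum := Finset.sum_le_sum hpt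
  rw [Finset.sum_add_distrib, Finset.sum_add_distrib, ← Finset.mul_sum, ← Finset.mul_sum,
    ← Finset.mul_sum] at hsum
  -- the error of the comparison candidate
  have hm : ∑ i ∈ I, (x m₀ i - p i) ^ 2 ≤ R + 4 * Q := by
    have h1 : ∀ i ∈ I, (x m₀ i - p i) ^ 2 ≤
        (x m₀ i - q m₀ i) ^ 2 + 4 * (if diag i then (1 : ℝ) else 0) := by
      intro i hi
      by_cases hd : diag i
      · have := abs_le.1 (hx m₀ i)
        rw [if_pos hd, hp i hd]
        nlinarith [sq_nonneg (x m₀ i - q m₀ i)]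
      · rw [if_neg hd, hq m₀ hm₀ i hi hd]; simp
    have h2 := Finset.sum_le_sum h1
    rw [Finset.sum_add_distrib, ← Finset.mul_sum] at h2
    linarith [hR m₀]
  -- Split `x̄ - x m₀` into averaged estimation error, averaged bias and the estimation error of
  -- `m₀`. The bias of `m₀` drops out: it is zero off the diagonal, and `a - p` is zero on it.
  have hnoise : ∑ i ∈ I, (a i - p i) * (∑ m, w m * x m i - x m₀ i) ≤ 2 * H + G := by
    have h1 : ∑ i ∈ I, (a i - p i) * (∑ m, w m * x m i - x m₀ i) =
        ∑ m, w m * (∑ i ∈ I, (a i - p i) * (x m i - q m i)) +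
        ∑ m, w m * (∑ i ∈ I, (a i - p i) * (q m i - p i)) -
        ∑ i ∈ I, (a i - p i) * (x m₀ i - q m₀ i) := by
      simp_rw [Finset.mul_sum]
      rw [Finset.sum_comm (s := Finset.univ), Finset.sum_comm (s := Finset.univ),
        ← Finset.sum_add_distrib, ← Finset.sum_sub_distrib]
      refine Finset.sum_congr rfl fun i hi => ?_
      have h2 : ∑ m, w m * ((a i - p i) * (x m i - q m i)) +
          ∑ m, w m * ((a i - p i) * (q m i - p i)) =
          (a i - p i) * ∑ m, w m * (x m i - p i) := by
        rw [← Finset.sum_add_distrib, Finset.mul_sum]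
        exact Finset.sum_congr rfl fun m _ => by ring
      rw [h2, hsplit]
      by_cases hd : diag i
      · rw [ha i hd, hp i hd]; ring
      · rw [hq m₀ hm₀ i hi hd]; ring
    rw [h1]
    have h2 := abs_le.1 (abs_sum_mul_le Finset.univ w _ (fun m _ => hw0 m) hw1.le hH0
      fun m _ => hH m)
    have h3 := abs_le.1 (abs_sum_mul_le Finset.univ w _ (fun m _ => hw0 m) hw1.le hG0
      fun m _ => hG m)
    have h4 := abs_le.1 (hH m₀)
    linarith [h2.2, h3.2, h4.1]
  have hexp : ∑ i ∈ I, (a i - x m₀ i) ^ 2 - ∑ i ∈ I, (a i - ∑ m, w m * x m i) ^ 2 =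
      ∑ i ∈ I, (x m₀ i - p i) ^ 2 - ∑ i ∈ I, (∑ m, w m * x m i - p i) ^ 2 +
        2 * ∑ i ∈ I, (a i - p i) * (∑ m, w m * x m i - x m₀ i) := by
    rw [Finset.mul_sum, ← Finset.sum_sub_distrib, ← Finset.sum_sub_distrib,
      ← Finset.sum_add_distrib]
    exact Finset.sum_congr rfl fun i _ => by ring
  linarith

/-! ### Cross-validation as least squares over the observed entries -/

namespace Setting

variable (S : Setting)

/-- `K / (K - 1) ≤ 2` because `K ≥ 2`. Predictions are therefore bounded whatever gradient descent
returns. -/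
theorem f1_mem (x : ℝ) : 0 ≤ S.f1 x ∧ S.f1 x ≤ 2 := by
  have hK : (2 : ℝ) ≤ S.K := by exact_mod_cast S.two_le_K
  have he := Real.exp_pos (-x)
  have hpos : 0 < (1 + Real.exp (-x)) * ((S.K : ℝ) - 1) := by
    apply mul_pos <;> linarith
  unfold f1
  refine ⟨div_nonneg (by linarith) hpos.le, (div_le_iff₀ hpos).2 ?_⟩
  nlinarith [mul_pos he (by linarith : (0 : ℝ) < S.K - 1)]

/-- The cross-validation prediction `∑ₖ P̃⁽ᵗ⁾[k]₍ₘ₎` at `(t, i, j)`. -/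
noncomputable def pred (A : S.Adj) (m : Fin S.M) (p : Fin S.T × Fin S.N × Fin S.N) : ℝ :=
  ∑ k, S.Ptilde A m k p.1 p.2.1 p.2.2

theorem Ptilde_eq_zero (A : S.Adj) (m : Fin S.M) (k : Fin S.K) (t : Fin S.T) (i j : Fin S.N)
    (h : (i, j) ∉ S.G k) : S.Ptilde A m k t i j = 0 := by
  simp [Ptilde, h]

theorem mem_G (k : Fin S.K) (e : Fin S.N × Fin S.N) : e ∈ S.G k ↔ e ∈ S.Psi1 ∧ S.fold e = k := by
  simp [G]

theorem pred_eq (A : S.Adj) (m : Fin S.M) (p : Fin S.T × Fin S.N × Fin S.N) :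
    S.pred A m p = S.Ptilde A m (S.fold p.2) p.1 p.2.1 p.2.2 := by
  refine Finset.sum_eq_single _ (fun k _ hk => ?_) (by simp)
  exact S.Ptilde_eq_zero A m k _ _ _ fun h => hk ((S.mem_G k _).1 h).2.symm

theorem pred_mem (A : S.Adj) (m : Fin S.M) (p : Fin S.T × Fin S.N × Fin S.N) :
    0 ≤ S.pred A m p ∧ S.pred A m p ≤ 2 := by
  rw [pred_eq]
  simp only [Ptilde, Matrix.of_apply]
  split_ifs
  · exact S.f1_mem _
  · norm_num

/-- The index set of the observed entries in all layers. -/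
def obs : Finset (Fin S.T × Fin S.N × Fin S.N) := Finset.univ ×ˢ S.Psi1

theorem sum_obs (f : Fin S.T × Fin S.N × Fin S.N → ℝ) :
    ∑ p ∈ S.obs, f p = ∑ t, ∑ e ∈ S.Psi1, f (t, e) := Finset.sum_product _ _ _

/-- The folds partition `Ψ₁`, and outside a fold both the restricted data and its predictions
vanish, so each observed entry survives in exactly one summand. -/
theorem CV_eq (A : S.Adj) (w : Fin S.M → ℝ) :
    S.CV A w = 1 / ((S.T : ℝ) * S.Psi1.card) *
      ∑ p ∈ S.obs, (A p.1 p.2.1 p.2.2 - ∑ m, w m * S.pred A m p) ^ 2 := by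
  unfold CV
  congr 1
  rw [sum_obs]
  refine Finset.sum_congr rfl fun t _ => ?_
  have h1 : ∀ k, ∑ i, ∑ j,
      (restrict (S.G k) A t i j - ∑ m, w m * S.Ptilde A m k t i j) ^ 2 =
      ∑ e : Fin S.N × Fin S.N,
        (restrict (S.G k) A t e.1 e.2 - ∑ m, w m * S.Ptilde A m k t e.1 e.2) ^ 2 := fun k =>
    by rw [Fintype.sum_prod_type]
  simp_rw [h1]
  have h0 : ∀ k e, e ∉ S.G k →
      (restrict (S.G k) A t e.1 e.2 - ∑ m, w m * S.Ptilde A m k t e.1 e.2) ^ 2 = 0 := by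
    intro k e he
    simp [restrict, he, S.Ptilde_eq_zero A _ k t e.1 e.2 he]
  rw [Finset.sum_comm]
  symm
  refine Finset.sum_subset_zero_on_sdiff (Finset.subset_univ _) (fun e he => ?_) fun e he => ?_
  · refine Finset.sum_eq_zero fun k _ => h0 k e fun h => ?_
    exact (Finset.mem_sdiff.1 he).2 ((S.mem_G k e).1 h).1
  · rw [Finset.sum_eq_single (S.fold e) (fun k _ hk => h0 k e fun h =>
      hk ((S.mem_G k e).1 h).2.symm) (by simp)]
    have : e ∈ S.G (S.fold e) := (S.mem_G _ _).2 ⟨he, rfl⟩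
    simp only [pred_eq]
    simp [restrict, this]

theorem foldError_eq (A : S.Adj) (Pstar : S.Limits) (m : Fin S.M) :
    S.foldError A Pstar m =
      ∑ p ∈ S.obs, (S.pred A m p - Pstar m p.1 p.2.1 p.2.2) ^ 2 := by
  rw [sum_obs]; rfl

theorem lossStar_eq (Pstar : S.Limits) (w : Fin S.M → ℝ) :
    S.lossStar Pstar w = ∑ p ∈ S.obs,
      (∑ m, w m * Pstar m p.1 p.2.1 p.2.2 - S.model.prob p.1 p.2.1 p.2.2) ^ 2 := by
  rw [sum_obs]; rfl

theorem prob_mem {N T : ℕ} (θ : Model N T) (t : Fin T) (i j : Fin N) :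
    0 ≤ θ.prob t i j ∧ θ.prob t i j ≤ 1 := by
  simp only [Model.prob, Matrix.of_apply, sigma]
  split_ifs
  · norm_num
  · have := Real.exp_pos (-(theta θ.alpha (θ.Z t) i j))
    exact ⟨by positivity, (div_le_one (by linarith)).2 (by linarith)⟩

theorem card_obs_le : (S.obs.card : ℝ) ≤ S.T * S.N ^ 2 := by
  have : S.obs.card ≤ S.T * (S.N * S.N) := by
    simpa using Finset.card_le_univ S.obs
  rw [sq]; exact_mod_cast this

theorem card_diag_le :
    ((S.obs.filter fun p => p.2.1 = p.2.2).card : ℝ) ≤ S.N * S.T := by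
  have h : (S.obs.filter fun p => p.2.1 = p.2.2).card ≤
      (Finset.univ : Finset (Fin S.N × Fin S.T)).card := by
    refine Finset.card_le_card_of_injOn (fun p => (p.2.1, p.1)) (by simp) ?_
    rintro ⟨t, i, j⟩ h ⟨t', i', j'⟩ h' e
    simp at h h' e ⊢
    obtain ⟨h1, h2⟩ := e
    exact ⟨h2, h1, by rw [← h.2, ← h'.2, h1]⟩
  have : (S.obs.filter fun p => p.2.1 = p.2.2).card ≤ S.N * S.T := by simpa using h
  exact_mod_cast this

/-- A bound for the weight that cross-validation gives to the misspecified candidates. -/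
theorem exists_misspecified_loss_le (A : S.Adj) (hdiag : ∀ t i, A t i i = 0) (hPsi : S.Psi1.Nonempty)
    (Pstar : S.Limits)
    (hcorrect : ∀ m ∈ S.correct, ∀ t, ∀ e ∈ S.Psi1, e.1 ≠ e.2 →
      Pstar m t e.1 e.2 = S.model.prob t e.1 e.2)
    (hne : S.correct.Nonempty) {w : Fin S.M → ℝ} (hw : S.IsCVWeight A w)
    (hlt : ∑ m ∈ S.correct, w m < 1) {R V G : ℝ}
    (hR : ∀ m, S.foldError A Pstar m ≤ R)
    (hV : ∑ p ∈ S.obs, (A p.1 p.2.1 p.2.2 - S.model.prob p.1 p.2.1 p.2.2) ^ 2 ≤ V)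
    (hG : ∀ m, |∑ p ∈ S.obs, (A p.1 p.2.1 p.2.2 - S.model.prob p.1 p.2.1 p.2.2) *
      (Pstar m p.1 p.2.1 p.2.2 - S.model.prob p.1 p.2.1 p.2.2)| ≤ G) :
    ∃ v ∈ S.misspecifiedWeights, (1 - ∑ m ∈ S.correct, w m) ^ 2 * S.lossStar Pstar v ≤
      4 * R + 16 * (S.N * S.T) + 8 * √(V * R) + 4 * G := by
  obtain ⟨⟨hw0, hw1⟩, hmin⟩ := hw
  obtain ⟨m₀, hm₀⟩ := hne
  set s := 1 - ∑ m ∈ S.correct, w m with hs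
  have hspos : 0 < s := by linarith
  have hcompl : ∑ m ∈ S.correctᶜ, w m = s := by
    rw [hs, ← hw1, ← Finset.sum_add_sum_compl S.correct w]; ring
  -- The misspecified part of `w`, renormalised to total weight one; undoing the scaling yields the
  -- factor `s ^ 2`.
  let v : Fin S.M → ℝ := fun m => if m ∈ S.correctᶜ then w m / s else 0
  have hv : ∑ m ∈ S.correctᶜ, v m = 1 := by
    have : ∑ m ∈ S.correctᶜ, v m = ∑ m ∈ S.correctᶜ, w m / s :=
      Finset.sum_congr rfl fun m hm => if_pos hm
    rw [this, ← Finset.sum_div, hcompl, div_self hspos.ne']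
  have hv' : ∑ m, v m = 1 := by
    rw [← hv]; symm
    exact Finset.sum_subset (Finset.subset_univ _) fun m _ hm => if_neg hm
  refine ⟨v, ⟨⟨fun m => ?_, hv'⟩, hv⟩, ?_⟩
  · simp only [v]; split_ifs
    · exact div_nonneg (hw0 m) hspos.le
    · exact le_rfl
  have hloss : s ^ 2 * S.lossStar Pstar v = ∑ p ∈ S.obs,
      (∑ m ∈ S.correctᶜ, w m *
        (Pstar m p.1 p.2.1 p.2.2 - S.model.prob p.1 p.2.1 p.2.2)) ^ 2 := by
    rw [lossStar_eq, Finset.mul_sum]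
    refine Finset.sum_congr rfl fun p _ => ?_
    rw [← mul_pow]
    congr 1
    have h1 : ∑ m, v m * Pstar m p.1 p.2.1 p.2.2 =
        ∑ m ∈ S.correctᶜ, v m * Pstar m p.1 p.2.1 p.2.2 := by
      symm
      refine Finset.sum_subset (Finset.subset_univ _) fun m _ hm => ?_
      simp only [v, if_neg hm, zero_mul]
    simp_rw [mul_sub, Finset.sum_sub_distrib, ← Finset.sum_mul, hcompl]
    rw [h1, Finset.mul_sum]
    congr 1
    refine Finset.sum_congr rfl fun m hm => ?_
    simp only [v, if_pos hm]
    field_simp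
  rw [hloss]
  have hc : 0 < 1 / ((S.T : ℝ) * S.Psi1.card) := by
    have h1 : (0 : ℝ) < S.T := by exact_mod_cast S.T_pos
    have h2 : (0 : ℝ) < S.Psi1.card := by exact_mod_cast hPsi.card_pos
    positivity
  refine sum_sq_bias_le S.obs (fun p => A p.1 p.2.1 p.2.2)
    (fun p => S.model.prob p.1 p.2.1 p.2.2) (fun m p => S.pred A m p)
    (fun m p => Pstar m p.1 p.2.1 p.2.2) S.correct w hw0 hw1 hm₀ (fun p => p.2.1 = p.2.2)
    (fun m hm p hp hd => hcorrect m hm p.1 p.2 (Finset.mem_product.1 hp).2 hd)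
    (fun p hp => by simp [Model.prob, hp]) (fun p hp => by rw [hp]; exact hdiag _ _)
    (fun m p => ?_) ?_ (fun m => by rw [← foldError_eq]; exact hR m) (fun m => ?_) hG
    S.card_diag_le
  · have := S.pred_mem A m p
    exact abs_le.2 ⟨by linarith, this.2⟩
  · have h := hmin (Pi.single m₀ 1) (single_mem_stdSimplex ℝ m₀)
    rw [CV_eq, CV_eq] at h
    have h := le_of_mul_le_mul_left h hc
    simpa [Pi.single_apply] using h
  -- Cauchy–Schwarz rather than independence: folds need not be symmetric, so the training data may
  -- contain `(j, i)` when `(i, j)` is held out.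
  · refine Real.abs_le_sqrt ?_
    refine (Finset.sum_mul_sq_le_sq_mul_sq _ _ _).trans ?_
    refine mul_le_mul hV (by rw [← foldError_eq]; exact hR m)
      (Finset.sum_nonneg fun _ _ => sq_nonneg _) ((Finset.sum_nonneg fun _ _ => sq_nonneg _).trans hV)

/-- Limiting values that are close to some predictions are at bounded distance to the truth. -/
theorem sum_sq_limit_sub_prob_le (A : S.Adj) (Pstar : S.Limits) (m : Fin S.M) {R : ℝ}
    (hR : S.foldError A Pstar m ≤ R) :
    ∑ p ∈ S.obs, (Pstar m p.1 p.2.1 p.2.2 - S.model.prob p.1 p.2.1 p.2.2) ^ 2 ≤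
      8 * (S.T * S.N ^ 2) + 2 * R := by
  rw [foldError_eq] at hR
  have h : ∀ p ∈ S.obs, (Pstar m p.1 p.2.1 p.2.2 - S.model.prob p.1 p.2.1 p.2.2) ^ 2 ≤
      8 + 2 * (S.pred A m p - Pstar m p.1 p.2.1 p.2.2) ^ 2 := by
    intro p _
    have h1 := S.pred_mem A m p
    have h2 := prob_mem S.model p.1 p.2.1 p.2.2
    have h3 : (S.pred A m p - S.model.prob p.1 p.2.1 p.2.2) ^ 2 ≤ 2 ^ 2 :=
      sq_le_sq' (by linarith) (by linarith)
    nlinarith [sq_nonneg ((S.pred A m p - S.model.prob p.1 p.2.1 p.2.2) +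
      (S.pred A m p - Pstar m p.1 p.2.1 p.2.2))]
  have h := Finset.sum_le_sum h
  rw [Finset.sum_add_distrib, ← Finset.mul_sum, Finset.sum_const, nsmul_eq_mul] at h
  linarith [S.card_obs_le]

end Setting

end NetMA

/-! ### Moments and tail bounds of the noise -/

namespace NetMA

/-- Groups the two orientations of each edge, since only the entries with `i < j` are independent.
-/
theorem sum_eq_sum_lt_add_swap {N T : ℕ} (f : Fin T × Fin N × Fin N → ℝ)
    (hf : ∀ t i, f (t, i, i) = 0) :
    ∑ p, f p = ∑ e : {e : Fin T × Fin N × Fin N // e.2.1 < e.2.2},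
      (f e.1 + f (e.1.1, e.1.2.2, e.1.2.1)) := by
  have h1 : ∀ g : Fin T × Fin N × Fin N → ℝ,
      ∑ e : {e : Fin T × Fin N × Fin N // e.2.1 < e.2.2}, g e.1 =
        ∑ p, if p.2.1 < p.2.2 then g p else 0 := fun g => by
    rw [← Finset.sum_filter]
    exact (Finset.sum_subtype _ (by simp) g).symm
  have h2 : ∑ p : Fin T × Fin N × Fin N, (if p.2.1 < p.2.2 then f (p.1, p.2.2, p.2.1) else 0) =
      ∑ p, if p.2.2 < p.2.1 then f p else 0 :=
    Equiv.sum_comp ((Equiv.refl (Fin T)).prodCongr (Equiv.prodComm (Fin N) (Fin N)))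
      fun p => if p.2.2 < p.2.1 then f p else 0
  rw [Finset.sum_add_distrib, h1 f, h1 fun p => f (p.1, p.2.2, p.2.1), h2,
    ← Finset.sum_add_distrib]
  refine Finset.sum_congr rfl fun p _ => ?_
  obtain ⟨t, i, j⟩ := p
  rcases lt_trichotomy i j with h | rfl | h
  · simp [h, h.not_gt]
  · simp [hf]
  · simp [h, h.not_gt]

theorem Model.prob_symm {N T : ℕ} (θ : Model N T) (t : Fin T) (i j : Fin N) :
    θ.prob t i j = θ.prob t j i := by
  have : theta θ.alpha (θ.Z t) i j = theta θ.alpha (θ.Z t) j i := by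
    simp only [theta, Matrix.of_apply, Matrix.mul_apply, Matrix.transpose_apply]
    rw [add_comm (θ.alpha i)]
    congr 1
    exact Finset.sum_congr rfl fun k _ => mul_comm _ _
  simp only [Model.prob, Matrix.of_apply, this, eq_comm (a := i)]

namespace IsNetwork

variable {N T : ℕ} {Ω : Type*} [MeasurableSpace Ω] {θ : Model N T} {μ : Measure Ω}
  {A : Ω → Fin T → Matrix (Fin N) (Fin N) ℝ}

theorem integral_eq_of_lt (hA : IsNetwork θ μ A) (t : Fin T) {i j : Fin N} (hij : i < j) :
    ∫ ω, A ω t i j ∂μ = θ.prob t i j := by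
  have h : (fun ω => A ω t i j) = {ω | A ω t i j = 1}.indicator 1 := by
    ext ω
    rcases hA.binary ω t i j with h | h <;> simp [Set.indicator, h]
  have hm : MeasurableSet {ω | A ω t i j = 1} := hA.measurable t i j (measurableSet_singleton 1)
  rw [h, integral_indicator_one hm, Measure.real, hA.bernoulli t i j hij, ENNReal.toReal_ofReal (Setting.prob_mem θ t i j).1]

theorem integral_eq (hA : IsNetwork θ μ A) (t : Fin T) (i j : Fin N) :
    ∫ ω, A ω t i j ∂μ = θ.prob t i j := by
  rcases lt_trichotomy i j with h | rfl | h
  · exact hA.integral_eq_of_lt t h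
  · simp [hA.diag, Model.prob]
  · rw [θ.prob_symm, ← hA.integral_eq_of_lt t h]
    simp_rw [hA.symm _ t i j]

variable [IsProbabilityMeasure μ]

theorem integrable (hA : IsNetwork θ μ A) (t : Fin T) (i j : Fin N) :
    Integrable (fun ω => A ω t i j) μ := by
  refine Integrable.of_bound (hA.measurable t i j).aestronglyMeasurable 1 (.of_forall fun ω => ?_)
  rcases hA.binary ω t i j with h | h <;> simp [h]

theorem memLp_noise (hA : IsNetwork θ μ A) (t : Fin T) (i j : Fin N) :
    MemLp (fun ω => A ω t i j - θ.prob t i j) 2 μ := by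
  refine MemLp.of_bound ((hA.measurable t i j).sub_const _).aestronglyMeasurable 1
    (.of_forall fun ω => ?_)
  have h1 := Setting.prob_mem θ t i j
  rw [Real.norm_eq_abs, abs_le]
  rcases hA.binary ω t i j with h | h <;> rw [h] <;> constructor <;> linarith

theorem integral_noise (hA : IsNetwork θ μ A) (t : Fin T) (i j : Fin N) :
    ∫ ω, (A ω t i j - θ.prob t i j) ∂μ = 0 := by
  rw [integral_sub (hA.integrable t i j) (integrable_const _), hA.integral_eq]
  simp

theorem integral_noise_sq_le (hA : IsNetwork θ μ A) (t : Fin T) (i j : Fin N) :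
    ∫ ω, (A ω t i j - θ.prob t i j) ^ 2 ∂μ ≤ θ.prob t i j := by
  -- Since `A² = A`, the square is affine in `A`, with mean `p(1 - p) ≤ p`.
  have h : (fun ω => (A ω t i j - θ.prob t i j) ^ 2) =
      fun ω => (1 - 2 * θ.prob t i j) * A ω t i j + θ.prob t i j ^ 2 := by
    ext ω
    rcases hA.binary ω t i j with h | h <;> rw [h] <;> ring
  rw [h, integral_add ((hA.integrable t i j).const_mul _) (integrable_const _),
    integral_const_mul, hA.integral_eq]
  simp only [integral_const, probReal_univ, one_smul]
  nlinarith [sq_nonneg (θ.prob t i j)]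

theorem variance_noise_le (hA : IsNetwork θ μ A) (t : Fin T) (i j : Fin N) :
    Var[fun ω => A ω t i j - θ.prob t i j; μ] ≤ θ.prob t i j := by
  rw [variance_eq_integral (hA.memLp_noise t i j).aemeasurable, hA.integral_noise]
  simpa using hA.integral_noise_sq_le t i j

/-- Markov's inequality for the squared norm of the noise. -/
theorem measure_sum_noise_sq_gt_le (hA : IsNetwork θ μ A) (I : Finset (Fin T × Fin N × Fin N))
    {b V : ℝ} (hV : 0 < V) (hb : ∀ t i j, θ.prob t i j ≤ b) :
    μ {ω | V < ∑ p ∈ I, (A ω p.1 p.2.1 p.2.2 - θ.prob p.1 p.2.1 p.2.2) ^ 2} ≤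
      ENNReal.ofReal (I.card * b / V) := by
  have hint : ∀ p : Fin T × Fin N × Fin N,
      Integrable (fun ω => (A ω p.1 p.2.1 p.2.2 - θ.prob p.1 p.2.1 p.2.2) ^ 2) μ :=
    fun p => (hA.memLp_noise _ _ _).integrable_sq
  have h1 := mul_meas_ge_le_integral_of_nonneg (μ := μ)
    (f := fun ω => ∑ p ∈ I, (A ω p.1 p.2.1 p.2.2 - θ.prob p.1 p.2.1 p.2.2) ^ 2)
    (.of_forall fun ω => Finset.sum_nonneg fun _ _ => sq_nonneg _)
    (integrable_finsetSum _ fun p _ => hint p) V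
  rw [integral_finsetSum _ fun p _ => hint p] at h1
  have h2 : ∑ p ∈ I, ∫ ω, (A ω p.1 p.2.1 p.2.2 - θ.prob p.1 p.2.1 p.2.2) ^ 2 ∂μ ≤ I.card * b := by
    rw [← nsmul_eq_mul]
    exact Finset.sum_le_card_nsmul _ _ _ fun p _ =>
      (hA.integral_noise_sq_le _ _ _).trans (hb _ _ _)
  have h3 : μ {ω | V < ∑ p ∈ I, (A ω p.1 p.2.1 p.2.2 - θ.prob p.1 p.2.1 p.2.2) ^ 2} ≤
      μ {ω | V ≤ ∑ p ∈ I, (A ω p.1 p.2.1 p.2.2 - θ.prob p.1 p.2.1 p.2.2) ^ 2} :=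
    measure_mono fun ω hω => le_of_lt (Set.mem_ofPred.1 hω)
  refine h3.trans ((ENNReal.le_ofReal_iff_toReal_le (measure_ne_top _ _) ?_).2
      ((le_div_iff₀' hV).2 (h1.trans h2)))
  refine div_nonneg (le_trans ?_ h2) hV.le
  exact Finset.sum_nonneg fun _ _ => integral_nonneg fun _ => sq_nonneg _

/-- Chebyshev's inequality for a linear functional of the noise. -/
theorem measure_abs_sum_noise_mul_ge_le (hA : IsNetwork θ μ A)
    (I : Finset (Fin T × Fin N × Fin N)) (a : Fin T × Fin N × Fin N → ℝ) {b c : ℝ}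
    (hb0 : 0 ≤ b) (hc : 0 < c) (hb : ∀ t i j, θ.prob t i j ≤ b) :
    μ {ω | c ≤ |∑ p ∈ I, (A ω p.1 p.2.1 p.2.2 - θ.prob p.1 p.2.1 p.2.2) * a p|} ≤
      ENNReal.ofReal (2 * b * (∑ p ∈ I, a p ^ 2) / c ^ 2) := by
  -- Extends the coefficients by zero and drops the diagonal, where there is no noise. `Y e` then
  -- collects both orientations, and `(g + g')² ≤ 2(g² + g'²)` gives the factor 2 in the bound.
  let g : Fin T × Fin N × Fin N → ℝ := fun p => if p ∈ I ∧ p.2.1 ≠ p.2.2 then a p else 0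
  let Y : {e : Fin T × Fin N × Fin N // e.2.1 < e.2.2} → Ω → ℝ := fun e ω =>
    (g e.1 + g (e.1.1, e.1.2.2, e.1.2.1)) *
      (A ω e.1.1 e.1.2.1 e.1.2.2 - θ.prob e.1.1 e.1.2.1 e.1.2.2)
  have hg : ∀ t i, g (t, i, i) = 0 := fun t i => by simp [g]
  have hsum : ∀ ω, ∑ p ∈ I, (A ω p.1 p.2.1 p.2.2 - θ.prob p.1 p.2.1 p.2.2) * a p =
      ∑ e, Y e ω := by
    intro ω
    have h1 : ∑ p ∈ I, (A ω p.1 p.2.1 p.2.2 - θ.prob p.1 p.2.1 p.2.2) * a p =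
        ∑ p, (A ω p.1 p.2.1 p.2.2 - θ.prob p.1 p.2.1 p.2.2) * g p := by
      refine (Finset.sum_subset_zero_on_sdiff (Finset.subset_univ I) (fun p hp => ?_)
        fun p hp => ?_)
      · have : p ∉ I := (Finset.mem_sdiff.1 hp).2
        simp [g, this]
      · by_cases h : p.2.1 = p.2.2
        · rw [h, hA.diag]; simp [Model.prob]
        · simp [g, hp, h]
    rw [h1, sum_eq_sum_lt_add_swap _ fun t i => by simp [hg]]
    refine Finset.sum_congr rfl fun e _ => ?_
    simp only [Y]
    rw [hA.symm ω e.1.1 e.1.2.2, θ.prob_symm e.1.1 e.1.2.2]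
    ring
  have hYp : ∀ e, MemLp (Y e) 2 μ := fun e => (hA.memLp_noise _ _ _).const_mul _
  have hvar : ∑ e, Var[Y e; μ] ≤ 2 * b * ∑ p ∈ I, a p ^ 2 := by
    have h1 : ∀ e, Var[Y e; μ] ≤
        2 * b * (g e.1 ^ 2 + g (e.1.1, e.1.2.2, e.1.2.1) ^ 2) := by
      intro e
      have h2 : Var[Y e; μ] = (g e.1 + g (e.1.1, e.1.2.2, e.1.2.1)) ^ 2 *
          Var[fun ω => A ω e.1.1 e.1.2.1 e.1.2.2 - θ.prob e.1.1 e.1.2.1 e.1.2.2; μ] :=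
        variance_const_mul _ _ _
      rw [h2]
      refine (mul_le_mul_of_nonneg_left ((hA.variance_noise_le _ _ _).trans (hb _ _ _))
        (sq_nonneg _)).trans ?_
      nlinarith [mul_nonneg hb0 (sq_nonneg (g e.1 - g (e.1.1, e.1.2.2, e.1.2.1)))]
    refine (Finset.sum_le_sum fun e _ => h1 e).trans ?_
    rw [← Finset.mul_sum, ← sum_eq_sum_lt_add_swap (fun p => g p ^ 2) fun t i => by simp [hg]]
    refine mul_le_mul_of_nonneg_left ?_ (by positivity)
    have h3 : ∑ p ∈ I, g p ^ 2 = ∑ p, g p ^ 2 :=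
      Finset.sum_subset (Finset.subset_univ I) fun p _ hp => by simp [g, hp]
    rw [← h3]
    refine Finset.sum_le_sum fun p _ => ?_
    simp only [g]
    split_ifs
    · exact le_rfl
    · simpa using sq_nonneg (a p)
  have hind : iIndepFun Y μ :=
    hA.indep.comp (fun e x => (g e.1 + g (e.1.1, e.1.2.2, e.1.2.1)) *
      (x - θ.prob e.1.1 e.1.2.1 e.1.2.2)) fun e => by fun_prop
  have hmean : ∫ ω, (∑ e, Y e) ω ∂μ = 0 := by
    simp_rw [Finset.sum_apply]
    rw [integral_finsetSum _ fun e _ => (hYp e).integrable (by norm_num)]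
    refine Finset.sum_eq_zero fun e _ => ?_
    simp only [Y]
    rw [integral_const_mul, hA.integral_noise, mul_zero]
  have hcheb := meas_ge_le_variance_div_sq (memLp_finsetSum' Finset.univ fun e _ => hYp e) hc
  rw [hmean, IndepFun.variance_sum (fun e _ => hYp e)
    fun e _ e' _ h => hind.indepFun h] at hcheb
  simp_rw [hsum]
  simp only [Finset.sum_apply, sub_zero] at hcheb
  exact hcheb.trans (ENNReal.ofReal_le_ofReal (div_le_div_of_nonneg_right hvar (sq_nonneg c)))

end IsNetwork

end NetMA

/-! ### Probability bound at a fixed index -/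

namespace NetMA

namespace Setting

variable (S : Setting)

theorem lossStar_nonneg (Pstar : S.Limits) (v : Fin S.M → ℝ) : 0 ≤ S.lossStar Pstar v := by
  rw [lossStar_eq]
  exact Finset.sum_nonneg fun _ _ => sq_nonneg _

/-- Turns a rate condition in `[0, ∞]` into a real inequality at any misspecified weight, as the
infimum lies below each loss. The product form needs no separate case for zero loss. -/
theorem le_mul_lossStar (Pstar : S.Limits) {v : Fin S.M → ℝ} (hv : v ∈ S.misspecifiedWeights)
    {a k : ℝ} (hk : 0 ≤ k)
    (h : ENNReal.ofReal a * (S.infLossStar Pstar)⁻¹ ≤ ENNReal.ofReal k) :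
    a ≤ k * S.lossStar Pstar v := by
  have h1 : S.infLossStar Pstar ≤ ENNReal.ofReal (S.lossStar Pstar v) := iInf₂_le v hv
  have h2 : ENNReal.ofReal a / ENNReal.ofReal (S.lossStar Pstar v) ≤ ENNReal.ofReal k := by
    rw [div_eq_mul_inv]
    exact (mul_le_mul_right (ENNReal.inv_le_inv.2 h1) _).trans h
  rw [ENNReal.div_le_iff_le_mul (.inr ENNReal.ofReal_ne_top) (.inl ENNReal.ofReal_ne_top),
    ← ENNReal.ofReal_mul hk] at h2
  exact (ENNReal.ofReal_le_ofReal_iff (mul_nonneg hk (S.lossStar_nonneg Pstar v))).1 h2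

/-- The correct candidates get weight close to one, up to probability `3 δ`, if the squared errors
of the predictions are at most `C N M T` and the misspecified loss dominates `N M T`. -/
theorem measure_le_abs_weight_sub_one_le {Ω : Type*} [MeasurableSpace Ω] {μ : Measure Ω}
    [IsProbabilityMeasure μ] {A : Ω → S.Adj} (hA : IsNetwork S.model μ A) (hN : 2 ≤ S.N)
    (hPsi : S.Psi1.Nonempty) (hMN : S.M ≤ S.N) (Pstar : S.Limits)
    (hcorrect : ∀ m ∈ S.correct, ∀ t, ∀ e ∈ S.Psi1, e.1 ≠ e.2 →
      Pstar m t e.1 e.2 = S.model.prob t e.1 e.2)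
    (hne : S.correct.Nonempty) {D : ℝ} (hD : ∀ t i j, S.model.prob t i j ≤ D / S.N)
    {what : Ω → Fin S.M → ℝ} (hw : ∀ ω, S.IsCVWeight (A ω) (what ω))
    {C δ k b ε : ℝ} (hC : 0 ≤ C) (hδ : 0 < δ) (hδ1 : δ ≤ 1 / 2) (hk : 0 < k) (hb : 0 ≤ b)
    (hε : 0 < ε)
    (hkε : (4 * C + 16) * k + 12 * √((16 + 4 * C) / δ * (k * b)) < ε ^ 2)
    (hfold : μ {ω | ∃ m, C * (S.N * S.M * S.T) < |S.foldError (A ω) Pstar m|} ≤ ENNReal.ofReal δ)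
    (hlittle : ENNReal.ofReal (S.N * S.M * S.T) * (S.infLossStar Pstar)⁻¹ ≤ ENNReal.ofReal k)
    (hbig : ENNReal.ofReal (S.N * S.T * max D (Real.log S.N)) * (S.infLossStar Pstar)⁻¹ ≤
      ENNReal.ofReal b) :
    μ {ω | ε ≤ |∑ m ∈ S.correct, what ω m - 1|} ≤ ENNReal.ofReal (3 * δ) := by
  have hN2 : (2 : ℝ) ≤ S.N := by exact_mod_cast hN
  have hN0 : (0 : ℝ) < S.N := by linarith
  have hT1 : (1 : ℝ) ≤ S.T := by exact_mod_cast S.T_pos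
  have hT0 : (0 : ℝ) < S.T := by linarith
  have hM1 : (1 : ℝ) ≤ S.M := by
    obtain ⟨m, -⟩ := hne
    exact_mod_cast (Nat.zero_le _).trans_lt m.2
  have hM0 : (0 : ℝ) < S.M := by linarith
  have hMN' : (S.M : ℝ) ≤ S.N := by exact_mod_cast hMN
  -- The logarithm makes `E` positive for `N ≥ 2`.
  set E := max D (Real.log S.N) with hEdef
  have hE : 0 < E := lt_max_of_lt_right (Real.log_pos (by linarith))
  set a : ℝ := S.N * S.M * S.T with ha_def
  set B : ℝ := S.N * S.T * E with hB_def
  have ha : 0 < a := by positivity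
  have hB : 0 < B := by positivity
  have hNTa : (S.N : ℝ) * S.T ≤ a := by
    rw [ha_def]; nlinarith [mul_pos hN0 hT0]
  have hNT1 : 1 ≤ (S.N : ℝ) * S.T := by nlinarith
  have hEB : E ≤ B := le_mul_of_one_le_left hE.le hNT1
  have hprob : ∀ t i j, S.model.prob t i j ≤ E / S.N := fun t i j =>
    (hD t i j).trans (div_le_div_of_nonneg_right (le_max_left _ _) hN0.le)
  -- Twice the constant `8 + 2C` of `hQ`, where 2 is the Chebyshev factor, divided by the allowed
  -- probability.
  set c := (16 + 4 * C) / δ with hc_def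
  have hc : 0 < c := by positivity
  set G := √(c * (a * B)) with hG_def
  have hG : 0 < G := Real.sqrt_pos.2 (by positivity)
  have hGsq : G ^ 2 = c * (a * B) := Real.sq_sqrt (by positivity)
  let bad₁ : Set Ω := {ω | ∃ m, C * a < |S.foldError (A ω) Pstar m|}
  let bad₂ : Set Ω := {ω | B / δ <
    ∑ p ∈ S.obs, (A ω p.1 p.2.1 p.2.2 - S.model.prob p.1 p.2.1 p.2.2) ^ 2}
  let bad₃ : Fin S.M → Set Ω := fun m => {ω | G ≤
    |∑ p ∈ S.obs, (A ω p.1 p.2.1 p.2.2 - S.model.prob p.1 p.2.1 p.2.2) *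
      (Pstar m p.1 p.2.1 p.2.2 - S.model.prob p.1 p.2.1 p.2.2)|}
  -- The limits are non-random, so a single good outcome bounds their distance to the truth; one
  -- exists because `δ < 1`.
  obtain ⟨ω₀, hω₀⟩ : ∃ ω, ω ∉ bad₁ := by
    by_contra! h
    have h1 : bad₁ = Set.univ := Set.eq_univ_of_forall h
    have h2 : (1 : ENNReal) ≤ ENNReal.ofReal δ := by
      rw [← measure_univ (μ := μ), ← h1]; exact hfold
    rw [ENNReal.one_le_ofReal] at h2
    linarith
  have hfoldle : ∀ ω, ω ∉ bad₁ → ∀ m, S.foldError (A ω) Pstar m ≤ C * a := by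
    intro ω hω m
    simp only [bad₁, Set.mem_ofPred_eq, not_exists, not_lt] at hω
    exact (le_abs_self _).trans (hω m)
  have hQ : ∀ m, ∑ p ∈ S.obs, (Pstar m p.1 p.2.1 p.2.2 - S.model.prob p.1 p.2.1 p.2.2) ^ 2 ≤
      (8 + 2 * C) * (S.T * S.N ^ 2) := by
    intro m
    refine (S.sum_sq_limit_sub_prob_le (A ω₀) Pstar m (hfoldle ω₀ hω₀ m)).trans ?_
    have h1 : a ≤ S.T * S.N ^ 2 := by
      rw [ha_def]; nlinarith [mul_le_mul_of_nonneg_left hMN' (mul_pos hN0 hT0).le]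
    nlinarith [mul_le_mul_of_nonneg_left h1 hC]
  have hbad₂ : μ bad₂ ≤ ENNReal.ofReal δ := by
    refine (hA.measure_sum_noise_sq_gt_le S.obs (by positivity) hprob).trans
      (ENNReal.ofReal_le_ofReal ?_)
    rw [div_le_iff₀ (by positivity), mul_div_cancel₀ _ hδ.ne']
    refine (mul_le_mul_of_nonneg_right S.card_obs_le (by positivity)).trans_eq ?_
    rw [hB_def]; field_simp
  have hbad₃ : ∀ m, μ (bad₃ m) ≤ ENNReal.ofReal (δ / S.M) := by
    intro m
    refine (hA.measure_abs_sum_noise_mul_ge_le S.obs _ (by positivity) hG hprob).trans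
      (ENNReal.ofReal_le_ofReal ?_)
    rw [div_le_iff₀ (by positivity), hGsq]
    refine (mul_le_mul_of_nonneg_left (hQ m) (by positivity)).trans ?_
    have h1 : 2 * (E / S.N) * ((8 + 2 * C) * (S.T * (S.N : ℝ) ^ 2)) =
        δ / S.M * (c * (a * E)) := by
      rw [hc_def, ha_def]; field_simp; ring
    rw [h1]
    -- Chebyshev requires only `c * (a * E)`; the cruder `E ≤ B` suffices.
    gcongr
  have hsub : {ω | ε ≤ |∑ m ∈ S.correct, what ω m - 1|} ⊆ bad₁ ∪ bad₂ ∪ ⋃ m, bad₃ m := by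
    intro ω hω
    by_contra hgood
    simp only [Set.mem_union, Set.mem_iUnion, not_or, not_exists] at hgood
    obtain ⟨⟨h₁, h₂⟩, h₃⟩ := hgood
    have hle : ∑ m ∈ S.correct, what ω m ≤ 1 := by
      rw [← (hw ω).1.2]
      exact Finset.sum_le_sum_of_subset_of_nonneg (Finset.subset_univ _)
        fun m _ _ => (hw ω).1.1 m
    have hs : ε ≤ 1 - ∑ m ∈ S.correct, what ω m := by
      rw [Set.mem_ofPred_eq, abs_sub_comm, abs_of_nonneg (by linarith)] at hω
      exact hω
    obtain ⟨v, hv, hvle⟩ := S.exists_misspecified_loss_le (A ω) (hA.diag ω) hPsi Pstar hcorrect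
      hne (hw ω) (by linarith) (hfoldle ω h₁) (not_lt.1 h₂) fun m => (not_le.1 (h₃ m)).le
    set L := S.lossStar Pstar v
    have haL : a ≤ k * L := S.le_mul_lossStar Pstar hv hk.le hlittle
    have hBL : B ≤ b * L := S.le_mul_lossStar Pstar hv hb hbig
    -- Strict positivity makes the final comparison with `hkε` a contradiction.
    have hL : 0 < L := pos_of_mul_pos_right (ha.trans_le haL) hk.le
    have hGL : G ≤ √(c * (k * b)) * L := by
      rw [hG_def]
      rw [Real.sqrt_le_left (by positivity), mul_pow, Real.sq_sqrt (by positivity)]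
      calc c * (a * B) ≤ c * ((k * L) * (b * L)) := by gcongr
        _ = c * (k * b) * L ^ 2 := by ring
    have hVG : √(B / δ * (C * a)) ≤ G := by
      refine Real.sqrt_le_sqrt ?_
      rw [hc_def]
      calc B / δ * (C * a) = C / δ * (a * B) := by ring
        _ ≤ (16 + 4 * C) / δ * (a * B) := by gcongr; linarith
    -- In `hkε`, `4C + 16` comes from the fold error and the diagonal (`NT ≤ a`), and `12 = 8 + 4`
    -- from the two noise terms, each at most a multiple of `G`.
    have h1 : ε ^ 2 * L ≤ (1 - ∑ m ∈ S.correct, what ω m) ^ 2 * L := by gcongr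
    have h2 : (4 * C + 16) * a ≤ (4 * C + 16) * (k * L) := by gcongr
    have h3 := mul_lt_mul_of_pos_right hkε hL
    linarith
  calc μ {ω | ε ≤ |∑ m ∈ S.correct, what ω m - 1|}
      ≤ μ (bad₁ ∪ bad₂ ∪ ⋃ m, bad₃ m) := measure_mono hsub
    _ ≤ μ bad₁ + μ bad₂ + ∑ m, μ (bad₃ m) :=
        (measure_union_le _ _).trans
          (add_le_add (measure_union_le _ _) (measure_iUnion_fintype_le μ bad₃))
    _ ≤ ENNReal.ofReal δ + ENNReal.ofReal δ + ∑ _m : Fin S.M, ENNReal.ofReal (δ / S.M) :=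
        add_le_add (add_le_add hfold hbad₂) (Finset.sum_le_sum fun m _ => hbad₃ m)
    _ = ENNReal.ofReal (3 * δ) := by
        rw [← ENNReal.ofReal_sum_of_nonneg fun _ _ => by positivity,
          ← ENNReal.ofReal_add hδ.le hδ.le, ← ENNReal.ofReal_add (by positivity) (by positivity)]
        congr 1
        simp only [Finset.sum_const, Finset.card_univ, Fintype.card_fin, nsmul_eq_mul]
        field_simp
        ring

end Setting

end NetMA

/-! ### Passage to the limit -/

theorem theorem5 (S : ℕ → NetMA.Setting)
    {Ω : ℕ → Type*} [∀ n, MeasurableSpace (Ω n)]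
    (μ : ∀ n, Measure (Ω n)) [∀ n, IsProbabilityMeasure (μ n)]
    (A : (n : ℕ) → Ω n → (S n).Adj)
    (hA : ∀ n, NetMA.IsNetwork (S n).model (μ n) (A n))
    -- the sample size tends to infinity
    (hPsi : Tendsto (fun n => (S n).Psi1.card) atTop atTop)
    -- limiting values of the estimators; for correct models they are the true probabilities
    (Pstar : (n : ℕ) → (S n).Limits)
    (hlim : NetMA.HaveLimits S μ A Pstar)
    (hcorrect : ∀ n, ∀ m ∈ (S n).correct, ∀ t, ∀ e ∈ (S n).Psi1, e.1 ≠ e.2 →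
      Pstar n m t e.1 e.2 = (S n).model.prob t e.1 e.2)
    -- the number of layers grows at most polynomially
    (hT : ∃ C₀ : ℝ, 0 < C₀ ∧
      Tendsto (fun n => ((S n).T : ℝ) * ((S n).N : ℝ) ^ (-C₀)) atTop (𝓝 0))
    -- `D` bounds the expected degrees
    (D : ℕ → ℝ)
    (hD : ∀ n t i j, (S n).model.prob t i j ≤ D n / (S n).N)
    (hloss : NetMA.MisspecifiedLossGrows S Pstar D)
    -- there is a correct candidate model
    (hne : ∀ n, (S n).correct.Nonempty)
    -- any choice of cross-validation weights
    (what : (n : ℕ) → Ω n → Fin (S n).M → ℝ)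
    (hw : ∀ n ω, (S n).IsCVWeight (A n ω) (what n ω)) :
    NetMA.TendstoInProb μ (fun n ω => ∑ m ∈ (S n).correct, what n ω m) 1 := by
  intro ε hε
  rw [ENNReal.tendsto_nhds_zero]
  intro η hη
  obtain ⟨δ, hδ, hδ1, hδη⟩ : ∃ δ : ℝ, 0 < δ ∧ δ ≤ 1 / 2 ∧ ENNReal.ofReal (3 * δ) ≤ η := by
    obtain ⟨x, hx0, hxη⟩ := ENNReal.lt_iff_exists_real_btwn.1 hη
    have hx : 0 < x := ENNReal.ofReal_pos.1 hxη.1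
    refine ⟨min (1 / 2) (x / 3), by positivity, min_le_left _ _,
      (ENNReal.ofReal_le_ofReal ?_).trans hxη.2.le⟩
    linarith [min_le_right (1 / 2) (x / 3)]
  obtain ⟨C, hC⟩ := hlim.fold δ hδ
  obtain ⟨b, hb⟩ := hloss.big
  -- The left-hand side is continuous in `k` and vanishes at `0`, so a small positive `k` works. It
  -- is chosen after `δ`, `C` and `b`; the `o(1)` condition then supplies it eventually.
  obtain ⟨k, hkε, hk⟩ : ∃ k : ℝ, (4 * max C 0 + 16) * k +
      12 * √((16 + 4 * max C 0) / δ * (k * max b 0)) < ε ^ 2 ∧ 0 < k := by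
    have hcont : Continuous fun k : ℝ => (4 * max C 0 + 16) * k +
        12 * √((16 + 4 * max C 0) / δ * (k * max b 0)) := by fun_prop
    have hlt : ∀ᶠ k in 𝓝 (0 : ℝ), (4 * max C 0 + 16) * k +
        12 * √((16 + 4 * max C 0) / δ * (k * max b 0)) < ε ^ 2 :=
      hcont.continuousAt.eventually_lt continuousAt_const (by simpa using by positivity)
    exact ((hlt.filter_mono nhdsWithin_le_nhds).and self_mem_nhdsWithin : ∀ᶠ k in 𝓝[>] (0 : ℝ),
      _ ∧ k ∈ Set.Ioi (0 : ℝ)).exists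
  have hlittle := (ENNReal.tendsto_nhds_zero.1 hloss.little) _ (ENNReal.ofReal_pos.2 hk)
  filter_upwards [hC, hb, hlittle, hPsi.eventually_ge_atTop 2] with n hCn hbn hkn hPn
  -- `2 ≤ |Ψ₁| ≤ N²` excludes `N ≤ 1`.
  have hN : 2 ≤ (S n).N := by
    have h1 : (S n).Psi1.card ≤ (S n).N * (S n).N := by
      simpa using Finset.card_le_univ (S n).Psi1
    by_contra! h
    nlinarith
  refine ((S n).measure_le_abs_weight_sub_one_le (hA n) hN (Finset.card_pos.1 (by omega))
    (hlim.M_le_N n) (Pstar n) (hcorrect n) (hne n) (hD n) (hw n) (le_max_right C 0) hδ hδ1 hk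
    (le_max_right b 0) hε hkε ((measure_mono ?_).trans hCn) hkn
    (hbn.trans (ENNReal.ofReal_le_ofReal (le_max_left _ _)))).trans hδη
  rintro ω ⟨m, hm⟩
  exact ⟨m, (mul_le_mul_of_nonneg_right (le_max_left _ _) (by positivity)).trans_lt hm⟩
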